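/- Let $n\ge 1$ and let $A\in\mathbb{C}^{n\times n}$ have index $k\ge 1$, where the index $\mathrm{Ind}(A)$ is the smallest integer $k\ge 0$ with $\operatorname{rk}(A^k)=\operatorname{rk}(A^{k+1})$. Let $A$ be written in a core EP decomposition $$A=U\begin{bmatrix}T&S\\0&N\end{bmatrix}U^*,$$ where $U\in\mathbb{C}^{n\times n}$ is unitary, $T\in\mathbb{C}^{t\times t}$ is nonsingular with $t=\operatorname{rk}(T)=\operatorname{rk}(A^k)$, $S\in\mathbb{C}^{t\times(n-t)}$, and $N\in\mathbb{C}^{(n-t)\times(n-t)}$ is nilpotent of index $k$. Put $\tilde T_k=\sum_{i=0}^{k-1}T^iSN^{k-1-i}$. Write $\mathcal R$ and $\mathcal N$ for range and null space. Let $A^\dagger$ be the Moore–Penrose inverse of $A$, and $A^d$ the Drazin inverse, that is, the unique matrix $X$ with $XAX=X$, $AX=XA$ and $XA^{k+1}=A^k$. Put $P_A=AA^\dagger$ and $Q_A=A^\dagger A$, and define - the core EP inverse $A^{\mathrm{core}}=A^k(A^{k+1})^\dagger$, - the DMP inverse $A^{d,\dagger}=A^dP_A$, - the CMP inverse $A^{c,\dagger}=Q_AA^{d,\dagger}$,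 - the MPCEP inverse $A^{\dagger,\mathrm{core}}=Q_AA^{\mathrm{core}}$, - the WG inverse $A^{\mathrm{w}}=(A^{\mathrm{core}})^2A$. Then the following conditions are equivalent: (a) $A$ is a WG matrix, i.e. $AA^{\mathrm{w}}=A^{\mathrm{w}}A$; (b) $A^{d,\dagger}=A^{\mathrm{core}}$; (c) $A^{\dagger,\mathrm{core}}=A^{c,\dagger}$; (d) $A^{\mathrm{core}}A^2=A^{\mathrm{core}}A^2A^{\mathrm{core}}A$; (e) $\mathcal R(N)\subseteq\mathcal N(\tilde T_k)$. -/

import Mathlib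

open scoped Matrix

set_option linter.unusedSectionVars false

namespace GenInv

section MoorePenrose

variable {m n : Type*} [Fintype m] [DecidableEq m] [Fintype n] [DecidableEq n]

/-- The four Penrose equations for `X` with respect to `A`. -/
structure IsMoorePenrose (A : Matrix m n ℂ) (X : Matrix n m ℂ) : Prop where
  inner : A * X * A = A
  outer : X * A * X = X
  left_hermitian : (A * X)ᴴ = A * X
  right_hermitian : (X * A)ᴴ = X * A

/-- If the range of `B` lies in that of `A`, then `B = A * C` for some `C`. -/
theorem exists_factor {l : Type*} [Fintype l] [DecidableEq l] (A : Matrix m n ℂ)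
    (B : Matrix m l ℂ) (h : LinearMap.range B.mulVecLin ≤ LinearMap.range A.mulVecLin) :
    ∃ C : Matrix n l ℂ, B = A * C := by
  have h1 : ∀ j : l, ∃ v : n → ℂ, A *ᵥ v = B.col j := by
    intro j
    have : B.col j ∈ LinearMap.range B.mulVecLin :=
      ⟨Pi.single j 1, by simp⟩
    obtain ⟨v, hv⟩ := h this
    exact ⟨v, by simpa using hv⟩
  choose v hv using h1
  refine ⟨Matrix.of fun i j => v j i, ?_⟩
  ext i j
  have := congrFun (hv j) i
  simpa [Matrix.mul_apply, Matrix.mulVec, dotProduct, Matrix.col] using this.symm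

/-- If `A * C` has the same rank as `A`, then `A = (A * C) * D` for some `D`. -/
theorem exists_factor_of_rank {l : Type*} [Fintype l] [DecidableEq l] (A : Matrix m n ℂ)
    (C : Matrix n l ℂ) (h : (A * C).rank = A.rank) : ∃ D : Matrix l n ℂ, A = A * C * D := by
  apply exists_factor
  apply le_of_eq
  symm
  apply Submodule.eq_of_le_of_finrank_eq
  · rw [Matrix.mulVecLin_mul]
    exact LinearMap.range_comp_le_range _ _
  · exact h

open scoped ComplexOrder in
/-- There is `W` with `A * W * A = A` and `A * W` Hermitian. -/
theorem exists_inner_left (A : Matrix m n ℂ) :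
    ∃ W : Matrix n m ℂ, A * W * A = A ∧ (A * W)ᴴ = A * W := by
  obtain ⟨W, hW⟩ := exists_factor_of_rank Aᴴ A
    (by rw [Matrix.rank_conjTranspose_mul_self, Matrix.rank_conjTranspose])
  have h1 : (A * W)ᴴ * A = A := by
    have := congrArg Matrix.conjTranspose hW
    simp only [Matrix.conjTranspose_mul, Matrix.conjTranspose_conjTranspose] at this
    rw [Matrix.conjTranspose_mul, Matrix.mul_assoc]
    exact this.symm
  have h2 : (A * W)ᴴ * (A * W) = A * W := by
    rw [← Matrix.mul_assoc, h1]
  have h3 : (A * W)ᴴ = A * W := by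
    have := congrArg Matrix.conjTranspose h2
    rw [Matrix.conjTranspose_mul, Matrix.conjTranspose_conjTranspose, h2] at this
    exact this.symm
  exact ⟨W, by rw [h3] at h1; exact h1, h3⟩

theorem exists_isMoorePenrose (A : Matrix m n ℂ) : ∃ X, IsMoorePenrose A X := by
  obtain ⟨W, hW, hW'⟩ := exists_inner_left A
  obtain ⟨V', hV, hV'⟩ := exists_inner_left Aᴴ
  have hVA : A * V'ᴴ * A = A := by
    have := congrArg Matrix.conjTranspose hV
    simpa [Matrix.mul_assoc] using this
  have hVh : (V'ᴴ * A)ᴴ = V'ᴴ * A := by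
    have := congrArg Matrix.conjTranspose hV'
    simpa using this
  have e1 : A * (V'ᴴ * A * W) = A * W := by
    rw [← Matrix.mul_assoc, ← Matrix.mul_assoc, hVA]
  have e2 : V'ᴴ * A * W * A = V'ᴴ * A := by
    rw [Matrix.mul_assoc, Matrix.mul_assoc, ← Matrix.mul_assoc A, hW]
  refine ⟨V'ᴴ * A * W, ?_, ?_, ?_, ?_⟩
  · rw [e1, hW]
  · rw [e2, Matrix.mul_assoc, e1, ← Matrix.mul_assoc]
  · rw [e1, hW']
  · rw [e2, hVh]

theorem IsMoorePenrose.unique {A : Matrix m n ℂ} {X Y : Matrix n m ℂ}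
    (hX : IsMoorePenrose A X) (hY : IsMoorePenrose A Y) : X = Y := by
  have h1 : A * X = A * Y := by
    calc A * X = (A * Y * A) * X := by rw [hY.inner]
      _ = (A * Y)ᴴ * (A * X)ᴴ := by
        rw [hY.left_hermitian, hX.left_hermitian, Matrix.mul_assoc]
      _ = (A * X * A * Y)ᴴ := by rw [← Matrix.conjTranspose_mul, ← Matrix.mul_assoc]
      _ = A * Y := by rw [hX.inner, hY.left_hermitian]
  have h2 : X * A = Y * A := by
    calc X * A = X * (A * Y * A) := by rw [hY.inner]
      _ = (X * A)ᴴ * (Y * A)ᴴ := by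
        rw [hX.right_hermitian, hY.right_hermitian]; simp only [Matrix.mul_assoc]
      _ = (Y * (A * X * A))ᴴ := by
        rw [← Matrix.conjTranspose_mul]; simp only [Matrix.mul_assoc]
      _ = Y * A := by rw [hX.inner, hY.right_hermitian]
  calc X = X * A * X := hX.outer.symm
    _ = Y * A * Y := by rw [h2, Matrix.mul_assoc, h1, ← Matrix.mul_assoc]
    _ = Y := hY.outer

/-- The Moore-Penrose inverse: the unique solution of the four Penrose equations. -/
noncomputable def moorePenrose (A : Matrix m n ℂ) : Matrix n m ℂ :=
  Classical.choose (exists_isMoorePenrose A)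

theorem moorePenrose_spec (A : Matrix m n ℂ) : IsMoorePenrose A (moorePenrose A) :=
  Classical.choose_spec (exists_isMoorePenrose A)

end MoorePenrose

section Square

variable {n : Type*} [Fintype n] [DecidableEq n]

/-- The index of `A`: the smallest `k ≥ 0` with `rk (A ^ k) = rk (A ^ (k + 1))`. -/
noncomputable def index (A : Matrix n n ℂ) : ℕ :=
  sInf {k : ℕ | (A ^ k).rank = (A ^ (k + 1)).rank}

theorem index_isLeast (A : Matrix n n ℂ) :
    IsLeast {k : ℕ | (A ^ k).rank = (A ^ (k + 1)).rank} (index A) := by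
  have hne : {k : ℕ | (A ^ k).rank = (A ^ (k + 1)).rank}.Nonempty := by
    by_contra hcon
    rw [Set.not_nonempty_iff_eq_empty] at hcon
    have hlt : ∀ k : ℕ, (A ^ (k + 1)).rank < (A ^ k).rank := by
      intro k
      refine lt_of_le_of_ne ?_ ?_
      · rw [pow_succ]
        exact Matrix.rank_mul_le_left _ _
      · intro h
        have : k ∈ {k : ℕ | (A ^ k).rank = (A ^ (k + 1)).rank} := h.symm
        rw [hcon] at this
        exact this
    have hb : ∀ k : ℕ, (A ^ k).rank + k ≤ (A ^ 0).rank := by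
      intro k
      induction k with
      | zero => simp
      | succ k ih => have := hlt k; omega
    have := hb ((A ^ 0).rank + 1)
    omega
  exact ⟨Nat.sInf_mem hne, fun _ h => Nat.sInf_le h⟩

/-- The equations of the Drazin inverse, where `k` is the index of `A`. -/
structure IsDrazin (A X : Matrix n n ℂ) : Prop where
  outer : X * A * X = X
  comm : A * X = X * A
  pow : X * A ^ (index A + 1) = A ^ index A

theorem exists_isDrazin (A : Matrix n n ℂ) : ∃ X, IsDrazin A X := by
  set k := index A with hk
  have hr : (A ^ k).rank = (A ^ (k + 1)).rank := (index_isLeast A).1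
  have key : ∀ B : Matrix n n ℂ, (B ^ k).rank = (B ^ (k + 1)).rank →
      ∃ C, B ^ k = B ^ (2 * k + 1) * C := by
    intro B hB
    obtain ⟨D, hD⟩ := exists_factor_of_rank (B ^ k) B (by rw [← pow_succ]; exact hB.symm)
    have hD' : B ^ k = B ^ (k + 1) * D := by rw [pow_succ]; exact hD
    have : ∀ j : ℕ, B ^ k = B ^ (k + j) * D ^ j := by
      intro j
      induction j with
      | zero => simp
      | succ j ih =>
        calc B ^ k = B ^ j * B ^ k * D ^ j := by rw [← pow_add, add_comm j k]; exact ih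
          _ = B ^ j * (B ^ (k + 1) * D) * D ^ j := by rw [← hD']
          _ = B ^ (k + (j + 1)) * D ^ (j + 1) := by
            rw [pow_succ' D j, show k + (j + 1) = j + (k + 1) by omega, pow_add B j]
            simp only [mul_assoc]
    exact ⟨D ^ (k + 1), by rw [show 2 * k + 1 = k + (k + 1) by omega]; exact this (k + 1)⟩
  obtain ⟨Y, hY⟩ := key A hr
  obtain ⟨Z', hZ'⟩ := key Aᵀ (by
    rw [← Matrix.transpose_pow, ← Matrix.transpose_pow, Matrix.rank_transpose,
      Matrix.rank_transpose]
    exact hr)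
  have hZ : A ^ k = Z'ᵀ * A ^ (2 * k + 1) := by
    have := congrArg Matrix.transpose hZ'
    simpa [Matrix.transpose_mul, Matrix.transpose_pow] using this
  generalize Z'ᵀ = Z at hZ
  have e : A ^ k * Y = Z * A ^ k := by
    calc A ^ k * Y = Z * A ^ (2 * k + 1) * Y := by rw [← hZ]
      _ = Z * A ^ k := by rw [mul_assoc, ← hY]
  refine ⟨A ^ k * Y, ?_, ?_, ?_⟩
  · calc A ^ k * Y * A * (A ^ k * Y) = Z * A ^ k * A * (A ^ k * Y) := by rw [e]
      _ = Z * A ^ (2 * k + 1) * Y := by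
        rw [show 2 * k + 1 = k + 1 + k by omega, pow_add A (k + 1) k, pow_succ]
        simp only [mul_assoc]
      _ = A ^ k * Y := by rw [← hZ]
  · calc A * (A ^ k * Y) = A * (Z * A ^ (2 * k + 1)) * Y := by rw [← hZ, mul_assoc]
      _ = A ^ k * A * Y := by
        rw [← hZ, ← pow_succ', ← pow_succ]
      _ = Z * (A * (A ^ (2 * k + 1) * Y)) := by
        rw [hZ]
        simp only [mul_assoc]
        rw [← mul_assoc (A ^ (2 * k + 1)) A Y, ← pow_succ, pow_succ', mul_assoc]
      _ = A ^ k * Y * A := by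
        rw [← hY, e, ← pow_succ', pow_succ, mul_assoc]
  · rw [← hk, e, mul_assoc, ← pow_add, show k + (k + 1) = 2 * k + 1 by omega, ← hZ]

theorem IsDrazin.unique {A X Y : Matrix n n ℂ} (hX : IsDrazin A X) (hY : IsDrazin A Y) :
    X = Y := by
  have hp : ∀ {W : Matrix n n ℂ}, IsDrazin A W → ∀ j : ℕ, W = W ^ (j + 1) * A ^ j := by
    intro W hW j
    have hc : Commute A W := hW.comm
    induction j with
    | zero => simp
    | succ j ih =>
      calc W = W * A * W := hW.outer.symm
        _ = W * A * (W ^ (j + 1) * A ^ j) := by rw [← ih]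
        _ = W * (A * W ^ (j + 1)) * A ^ j := by simp only [mul_assoc]
        _ = W ^ (j + 1 + 1) * A ^ (j + 1) := by
          rw [(hc.pow_right (j + 1)).eq, pow_succ' W (j + 1), pow_succ' A j]
          simp only [mul_assoc]
  have hcX : Commute A X := hX.comm
  have hcY : Commute A Y := hY.comm
  set k := index A with hk
  have h1 : X = X * A * Y := by
    calc X = X ^ (k + 1) * A ^ k := hp hX k
      _ = X ^ (k + 1) * (Y * A ^ (k + 1)) := by rw [hY.pow]
      _ = X ^ (k + 1) * A ^ k * (A * Y) := by
        rw [← (hcY.pow_left (k + 1)).eq, pow_succ A]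
        simp only [mul_assoc]
      _ = X * A * Y := by rw [← hp hX k, mul_assoc]
  have h2 : Y = X * A * Y := by
    calc Y = Y ^ (k + 1) * A ^ k := hp hY k
      _ = A ^ k * Y ^ (k + 1) := ((hcY.pow_pow k (k + 1)).eq).symm
      _ = X * A ^ (k + 1) * Y ^ (k + 1) := by rw [hX.pow]
      _ = X * A * (A ^ k * Y ^ (k + 1)) := by
        rw [pow_succ' A]
        simp only [mul_assoc]
      _ = X * A * Y := by rw [(hcY.pow_pow k (k + 1)).eq, ← hp hY k]
  rw [h1, ← h2]

/-- The Drazin inverse `A ^ d`. -/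
noncomputable def drazin (A : Matrix n n ℂ) : Matrix n n ℂ :=
  Classical.choose (exists_isDrazin A)

theorem drazin_spec (A : Matrix n n ℂ) : IsDrazin A (drazin A) :=
  Classical.choose_spec (exists_isDrazin A)

/-- The orthogonal projector `P_A = A A^†` onto the range of `A`. -/
noncomputable def projP (A : Matrix n n ℂ) : Matrix n n ℂ := A * moorePenrose A

/-- The orthogonal projector `Q_A = A^† A` onto the range of `Aᴴ`. -/
noncomputable def projQ (A : Matrix n n ℂ) : Matrix n n ℂ := moorePenrose A * A

/-- The core EP inverse `A ^ k (A ^ (k + 1))^†`, with `k` the index of `A`. -/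
noncomputable def coreEP (A : Matrix n n ℂ) : Matrix n n ℂ :=
  A ^ index A * moorePenrose (A ^ (index A + 1))

/-- The DMP inverse `A^d P_A`. -/
noncomputable def dmp (A : Matrix n n ℂ) : Matrix n n ℂ := drazin A * projP A

/-- The CMP inverse `Q_A A^{d,†}`, where `A^{d,†}` is the DMP inverse. -/
noncomputable def cmp (A : Matrix n n ℂ) : Matrix n n ℂ := projQ A * dmp A

/-- The MPCEP inverse: `Q_A` times the core EP inverse. -/
noncomputable def mpcep (A : Matrix n n ℂ) : Matrix n n ℂ := projQ A * coreEP A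

/-- The weak group (WG) inverse: the square of the core EP inverse times `A`. -/
noncomputable def weakGroup (A : Matrix n n ℂ) : Matrix n n ℂ := coreEP A ^ 2 * A

/-- `A` is a WG matrix if it commutes with its WG inverse. -/
def IsWGMatrix (A : Matrix n n ℂ) : Prop := A * weakGroup A = weakGroup A * A

end Square

section CoreEPDecomposition

variable {n t : ℕ}

/-- The `n × n` matrix with blocks `[T, S; 0, N]`, the first block having size `t ≤ n`. -/
def blockUpper (ht : t ≤ n) (T : Matrix (Fin t) (Fin t) ℂ) (S : Matrix (Fin t) (Fin (n - t)) ℂ)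
    (N : Matrix (Fin (n - t)) (Fin (n - t)) ℂ) : Matrix (Fin n) (Fin n) ℂ :=
  let e : Fin t ⊕ Fin (n - t) ≃ Fin n :=
    finSumFinEquiv.trans (finCongr (Nat.add_sub_of_le ht))
  Matrix.reindex e e (Matrix.fromBlocks T S 0 N)

/-- `A = U [T, S; 0, N] Uᴴ` is a core EP decomposition of `A`: `U` is unitary, `T` is a
nonsingular `t × t` matrix with `t = rk (A ^ k)`, and `N` is nilpotent of index `k`, where `k`
is the index of `A`. -/
structure IsCoreEPDecomposition (A : Matrix (Fin n) (Fin n) ℂ) (ht : t ≤ n)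
    (U : Matrix (Fin n) (Fin n) ℂ) (T : Matrix (Fin t) (Fin t) ℂ)
    (S : Matrix (Fin t) (Fin (n - t)) ℂ) (N : Matrix (Fin (n - t)) (Fin (n - t)) ℂ) : Prop where
  unitary : U ∈ Matrix.unitaryGroup (Fin n) ℂ
  eq : A = U * blockUpper ht T S N * Uᴴ
  nonsingular : IsUnit T
  rank_pow : t = (A ^ index A).rank
  nilpotent : N ^ index A = 0
  nilpotent_least : ∀ j < index A, N ^ j ≠ 0

/-- `T̃_m = ∑_{i=0}^{m-1} T^i S N^{m-1-i}`. -/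
def tildeT (T : Matrix (Fin t) (Fin t) ℂ) (S : Matrix (Fin t) (Fin (n - t)) ℂ)
    (N : Matrix (Fin (n - t)) (Fin (n - t)) ℂ) (m : ℕ) : Matrix (Fin t) (Fin (n - t)) ℂ :=
  ∑ i ∈ Finset.range m, T ^ i * S * N ^ (m - 1 - i)

end CoreEPDecomposition

end GenInv

namespace GenInv

section Square

variable {n : Type*} [Fintype n] [DecidableEq n] (A : Matrix n n ℂ)

/-! Let `k` be the index and `P` the orthogonal projector onto the range of `A ^ k`. The core EP
inverse is `A^d P`, and `A A^d P = P`, so conditions (a)-(d) become identities between `A`, `A^d`,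
`P` and `P_A`. Each is equivalent to the single equation `A ^ k (1 - P) A = 0`. The decomposition
enters only afterwards: in block form `P` is `diag(1, 0)`, so `(1 - P) A` is `diag(0, N)`, and `A ^
k` has rows `[T ^ k, T̃_k]` and `[0, 0]`. The product has `T̃_k N` as its only possibly nonzero
block, and its vanishing is (e). -/

/-- The orthogonal projector onto the range of `A ^ (index A + 1)`, which is the range of
`A ^ index A`. -/
noncomputable def coreProj : Matrix n n ℂ := projP (A ^ (index A + 1))

/-! ### Drazin inverse identities. -/

theorem drazin_mul_mul_drazin : drazin A * A * drazin A = drazin A := (drazin_spec A).outer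

theorem commute_drazin : Commute A (drazin A) := (drazin_spec A).comm

theorem drazin_mul_pow : drazin A * A ^ (index A + 1) = A ^ index A := (drazin_spec A).pow

theorem pow_mul_drazin : A ^ (index A + 1) * drazin A = A ^ index A := by
  rw [((commute_drazin A).pow_left _).eq, drazin_mul_pow]

/-- Iterates `X = X A X` with `X` commuting with `A`. At `j = index A` it turns an equation `A ^ k M
= A ^ k M'` into `A^d M = A^d M'`. -/
theorem drazin_eq_drazin_pow_mul_pow (j : ℕ) : drazin A = drazin A ^ (j + 1) * A ^ j := by
  induction j with
  | zero => simp
  | succ j ih =>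
    calc drazin A = drazin A * A * drazin A := (drazin_mul_mul_drazin A).symm
      _ = drazin A * A * (drazin A ^ (j + 1) * A ^ j) := by rw [← ih]
      _ = drazin A * (A * drazin A ^ (j + 1)) * A ^ j := by simp only [mul_assoc]
      _ = drazin A ^ (j + 1 + 1) * A ^ (j + 1) := by
        rw [((commute_drazin A).pow_right (j + 1)).eq, pow_succ' _ (j + 1), pow_succ' A j]
        simp only [mul_assoc]

/-! ### The projector `P` and the core EP inverse. -/

theorem isHermitian_coreProj : (coreProj A)ᴴ = coreProj A :=
  (moorePenrose_spec _).left_hermitian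

theorem coreProj_mul_self : coreProj A * coreProj A = coreProj A := by
  rw [coreProj, projP, ← mul_assoc, (moorePenrose_spec _).inner]

theorem coreProj_mul_pow_succ : coreProj A * A ^ (index A + 1) = A ^ (index A + 1) :=
  (moorePenrose_spec _).inner

theorem coreProj_mul_pow : coreProj A * A ^ index A = A ^ index A := by
  rw [← pow_mul_drazin, ← mul_assoc, coreProj_mul_pow_succ]

theorem coreProj_mul_drazin : coreProj A * drazin A = drazin A := by
  rw [drazin_eq_drazin_pow_mul_pow A (index A), ← ((commute_drazin A).pow_pow _ _).eq,
    ← mul_assoc, coreProj_mul_pow]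

theorem mul_drazin_mul_coreProj : A * drazin A * coreProj A = coreProj A := by
  rw [coreProj, projP, ← mul_assoc, mul_assoc A, drazin_mul_pow, ← pow_succ']

/-- The range of `P` is `A`-invariant: `A P = A^d A (A P)` lies in the range of `A^d`, which `P`
fixes. -/
theorem coreProj_mul_mul_coreProj : coreProj A * (A * coreProj A) = A * coreProj A := by
  have h : A * coreProj A = drazin A * (A * (A * coreProj A)) := by
    conv_lhs => rw [← mul_drazin_mul_coreProj]
    rw [(commute_drazin A).eq, ← mul_assoc A, ← mul_assoc A, (commute_drazin A).eq, mul_assoc,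
      mul_assoc]
  rw [h, ← mul_assoc, coreProj_mul_drazin]

theorem coreEP_eq : coreEP A = drazin A * coreProj A := by
  rw [coreProj, projP, ← mul_assoc, drazin_mul_pow, coreEP]

theorem mul_coreEP : A * coreEP A = coreProj A := by
  rw [coreEP_eq, ← mul_assoc, mul_drazin_mul_coreProj]

theorem mul_drazin_mul_coreEP : A * drazin A * coreEP A = coreEP A := by
  rw [coreEP_eq, ← mul_assoc, (commute_drazin A).eq, drazin_mul_mul_drazin]

theorem coreProj_mul_coreEP : coreProj A * coreEP A = coreEP A := by
  rw [coreEP_eq, ← mul_assoc, coreProj_mul_drazin]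

theorem projP_mul_self : projP A * A = A := (moorePenrose_spec A).inner

/-- Adjoint of `P_A P = P`, which holds because the range of `P` lies in that of `A`. -/
theorem coreProj_mul_projP : coreProj A * projP A = coreProj A := by
  have h : projP A * coreProj A = coreProj A := by
    rw [← mul_drazin_mul_coreProj A, mul_assoc A, ← mul_assoc, projP_mul_self]
  have hP : (projP A)ᴴ = projP A := (moorePenrose_spec A).left_hermitian
  simpa [hP, isHermitian_coreProj] using congrArg Matrix.conjTranspose h

/-! ### Reduction of (a)-(d) to one equation. -/

theorem isWGMatrix_iff : IsWGMatrix A ↔ coreProj A * A ^ 2 = A * (coreProj A * A) := by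
  have h1 : A * weakGroup A = coreEP A * A := by
    rw [weakGroup, sq, ← mul_assoc, ← mul_assoc, mul_coreEP, coreProj_mul_coreEP]
  have h2 : weakGroup A * A = coreEP A * (coreEP A * A ^ 2) := by
    simp only [weakGroup, sq, mul_assoc]
  rw [IsWGMatrix, h1, h2]
  constructor
  · intro h
    -- Left multiplication by `A` strips one core EP factor, since `A` times the core EP inverse is
    -- `P`.
    have h3 := congrArg (A * ·) h
    simp only [← mul_assoc] at h3
    rw [mul_coreEP, coreProj_mul_coreEP] at h3
    rw [h3, ← mul_assoc, mul_coreEP]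
  · intro h
    have h3 : coreEP A * A ^ 2 = coreProj A * A := by
      rw [coreEP_eq, mul_assoc, h, ← mul_assoc, ← mul_assoc, ← (commute_drazin A).eq,
        mul_drazin_mul_coreProj]
    rw [h3, ← mul_assoc, coreEP_eq, mul_assoc (drazin A) (coreProj A) (coreProj A),
      coreProj_mul_self]

/-- The right-hand side of (d) collapses to `P A` by invariance of the range of `P`; multiplying by
`A` or by `A^d` then passes between the two equations. -/
theorem coreEP_mul_sq_eq_iff :
    coreEP A * A ^ 2 = coreEP A * A ^ 2 * coreEP A * A ↔
      coreProj A * A ^ 2 = A * (coreProj A * A) := by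
  have h1 : coreEP A * A ^ 2 * coreEP A * A = coreProj A * A := by
    rw [sq, mul_assoc (coreEP A), mul_assoc A, mul_coreEP, coreEP_eq, mul_assoc (drazin A),
      coreProj_mul_mul_coreProj, ← mul_assoc, ← (commute_drazin A).eq, mul_drazin_mul_coreProj]
  rw [h1]
  constructor
  · intro h
    rw [← h, ← mul_assoc, mul_coreEP]
  · intro h
    rw [coreEP_eq, mul_assoc, h, ← mul_assoc, ← mul_assoc, ← (commute_drazin A).eq,
      mul_drazin_mul_coreProj]

theorem coreProj_mul_sq_eq_iff :
    coreProj A * A ^ 2 = A * (coreProj A * A) ↔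
      A ^ index A * ((1 - coreProj A) * A) = 0 := by
  rw [sub_mul, one_mul, mul_sub, sub_eq_zero, ← pow_succ]
  constructor
  · intro h
    -- Moving `P` past one factor `A` at a time; at `j = k` the left side is `A ^ (k + 1)`.
    have hj : ∀ j : ℕ, coreProj A * A ^ (j + 1) = A ^ j * (coreProj A * A) := by
      intro j
      induction j with
      | zero => simp
      | succ j ih =>
        rw [pow_succ, ← mul_assoc, ih, pow_succ, mul_assoc, mul_assoc, mul_assoc, ← sq, h]
    rw [← hj, coreProj_mul_pow_succ]
  · intro h
    have h1 : drazin A * A = drazin A * (coreProj A * A) := by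
      conv_lhs => rw [drazin_eq_drazin_pow_mul_pow A (index A)]
      conv_rhs => rw [drazin_eq_drazin_pow_mul_pow A (index A)]
      rw [mul_assoc, mul_assoc, ← h, pow_succ A]
    -- Thus `P A` is a product of `A` and `A^d`, so it commutes with `A`.
    have h2 : coreProj A * A = A * (drazin A * A) := by
      rw [h1, ← mul_assoc, ← mul_assoc, mul_drazin_mul_coreProj]
    rw [sq, ← mul_assoc, h2, mul_assoc A, ← mul_assoc A (drazin A), (commute_drazin A).eq]

theorem dmp_eq_coreEP_iff :
    dmp A = coreEP A ↔ A ^ index A * ((1 - coreProj A) * A) = 0 := by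
  rw [sub_mul, one_mul, mul_sub, sub_eq_zero, dmp, coreEP_eq]
  constructor
  · intro h
    -- The left factor turns `A^d` into `A ^ k`; the right factor absorbs `P_A`.
    have h1 := congrArg (A ^ (index A + 1) * · * A) h
    rwa [← mul_assoc, pow_mul_drazin, mul_assoc, projP_mul_self, ← mul_assoc, pow_mul_drazin,
      mul_assoc] at h1
  · intro h
    have h1 : drazin A * A = drazin A * (coreProj A * A) := by
      conv_lhs => rw [drazin_eq_drazin_pow_mul_pow A (index A)]
      conv_rhs => rw [drazin_eq_drazin_pow_mul_pow A (index A)]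
      rw [mul_assoc, mul_assoc, h]
    rw [projP, ← mul_assoc, h1, mul_assoc, mul_assoc (coreProj A), ← projP, coreProj_mul_projP]

/-- `Q_A` can be cancelled: `A Q_A = A`, and `A^d A` fixes both inverses because each starts with
`A^d`. -/
theorem mpcep_eq_cmp_iff : mpcep A = cmp A ↔ dmp A = coreEP A := by
  constructor
  · intro h
    have hQ : A * projQ A = A := by
      rw [projQ, ← mul_assoc]; exact (moorePenrose_spec A).inner
    have h1 := congrArg (drazin A * A * ·) h
    simp only [mpcep, cmp] at h1
    rw [mul_assoc, mul_assoc, ← mul_assoc A, ← mul_assoc A, hQ, ← mul_assoc, ← mul_assoc,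
      ← (commute_drazin A).eq, mul_drazin_mul_coreEP, dmp, ← mul_assoc, (commute_drazin A).eq,
      drazin_mul_mul_drazin] at h1
    exact h1.symm
  · intro h
    rw [mpcep, cmp, h]

end Square

section CoreEPDecomposition

variable {n t : ℕ}

/-! ### Block computations in the core EP decomposition. -/

theorem tildeT_succ (T : Matrix (Fin t) (Fin t) ℂ) (S : Matrix (Fin t) (Fin (n - t)) ℂ)
    (N : Matrix (Fin (n - t)) (Fin (n - t)) ℂ) (m : ℕ) :
    tildeT T S N (m + 1) = T ^ m * S + tildeT T S N m * N := by
  rw [tildeT, tildeT, Finset.sum_range_succ, Matrix.sum_mul, add_comm]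
  congr 1
  · simp
  · refine Finset.sum_congr rfl fun i hi => ?_
    -- Since `i < m`, the truncated subtraction satisfies `m - 1 - i + 1 = m - i`.
    have hi := Finset.mem_range.1 hi
    rw [Matrix.mul_assoc _ _ N, ← pow_succ]
    congr 2
    omega

theorem fromBlocks_pow (T : Matrix (Fin t) (Fin t) ℂ) (S : Matrix (Fin t) (Fin (n - t)) ℂ)
    (N : Matrix (Fin (n - t)) (Fin (n - t)) ℂ) (m : ℕ) :
    Matrix.fromBlocks T S 0 N ^ m = Matrix.fromBlocks (T ^ m) (tildeT T S N m) 0 (N ^ m) := by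
  induction m with
  | zero => simp [tildeT, Matrix.fromBlocks_one]
  | succ m ih =>
    rw [pow_succ, ih, Matrix.fromBlocks_multiply, tildeT_succ]
    simp [pow_succ]

/-- Reindexing of a block matrix followed by conjugation with the unitary `U`. -/
noncomputable def blockConj (ht : t ≤ n) (U : Matrix.unitaryGroup (Fin n) ℂ) :
    Matrix (Fin t ⊕ Fin (n - t)) (Fin t ⊕ Fin (n - t)) ℂ ≃⋆ₐ[ℂ] Matrix (Fin n) (Fin n) ℂ :=
  (StarAlgEquiv.ofAlgEquiv (Matrix.reindexAlgEquiv ℂ ℂ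
    (finSumFinEquiv.trans (finCongr (Nat.add_sub_of_le ht)))) fun _ => rfl).trans
    (Unitary.conjStarAlgAut ℂ _ U)

theorem blockConj_fromBlocks (ht : t ≤ n) (U : Matrix.unitaryGroup (Fin n) ℂ)
    (T : Matrix (Fin t) (Fin t) ℂ) (S : Matrix (Fin t) (Fin (n - t)) ℂ)
    (N : Matrix (Fin (n - t)) (Fin (n - t)) ℂ) :
    blockConj ht U (Matrix.fromBlocks T S 0 N) =
      (U : Matrix (Fin n) (Fin n) ℂ) * blockUpper ht T S N * (U : Matrix (Fin n) (Fin n) ℂ)ᴴ :=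
  rfl

variable {A U : Matrix (Fin n) (Fin n) ℂ} {ht : t ≤ n} {T : Matrix (Fin t) (Fin t) ℂ}
  {S : Matrix (Fin t) (Fin (n - t)) ℂ} {N : Matrix (Fin (n - t)) (Fin (n - t)) ℂ}

theorem IsCoreEPDecomposition.eq_blockConj (hA : IsCoreEPDecomposition A ht U T S N) :
    A = blockConj ht ⟨U, hA.unitary⟩ (Matrix.fromBlocks T S 0 N) := by
  rw [blockConj_fromBlocks]; exact hA.eq

theorem IsCoreEPDecomposition.pow_index (hA : IsCoreEPDecomposition A ht U T S N) :
    A ^ index A = blockConj ht ⟨U, hA.unitary⟩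
      (Matrix.fromBlocks (T ^ index A) (tildeT T S N (index A)) 0 0) := by
  calc A ^ index A
      = blockConj ht ⟨U, hA.unitary⟩ (Matrix.fromBlocks T S 0 N) ^ index A :=
        congrArg (· ^ index A) hA.eq_blockConj
    _ = _ := by rw [← map_pow, fromBlocks_pow, hA.nilpotent]

/-- Two Hermitian matrices with `D P = P` and `P D = D` are equal, by taking adjoints. -/
theorem IsCoreEPDecomposition.coreProj_eq (hA : IsCoreEPDecomposition A ht U T S N) :
    coreProj A = blockConj ht ⟨U, hA.unitary⟩ (Matrix.fromBlocks 1 0 0 0) := by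
  set D := blockConj ht ⟨U, hA.unitary⟩ (Matrix.fromBlocks 1 0 0 0) with hD
  have hDh : Dᴴ = D := by
    rw [← Matrix.star_eq_conjTranspose, hD, ← map_star, Matrix.star_eq_conjTranspose,
      Matrix.fromBlocks_conjTranspose]
    simp
  have hDA : D * A ^ index A = A ^ index A := by
    rw [hA.pow_index, hD, ← map_mul, Matrix.fromBlocks_multiply]
    simp
  have hDP : D * coreProj A = coreProj A := by
    rw [coreProj, projP, pow_succ, ← mul_assoc, ← mul_assoc, hDA]
  have hPD : coreProj A * D = D := by
    -- Inverting `T ^ k` writes `D` as a right multiple of `A ^ k`, so `P` fixes it.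
    obtain ⟨V, hV⟩ := (hA.nonsingular.pow (index A)).exists_right_inv
    have : D = A ^ index A * blockConj ht ⟨U, hA.unitary⟩ (Matrix.fromBlocks V 0 0 0) := by
      rw [hA.pow_index, hD, ← map_mul, Matrix.fromBlocks_multiply]
      simp [hV]
    rw [this, ← mul_assoc, coreProj_mul_pow]
  have := congrArg Matrix.conjTranspose hDP
  rw [Matrix.conjTranspose_mul, hDh, isHermitian_coreProj, hPD] at this
  exact this.symm

theorem IsCoreEPDecomposition.pow_mul_eq_zero_iff (hA : IsCoreEPDecomposition A ht U T S N) :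
    A ^ index A * ((1 - coreProj A) * A) = 0 ↔ tildeT T S N (index A) * N = 0 := by
  set φ := blockConj ht ⟨U, hA.unitary⟩
  have h1 : (1 - coreProj A) * A = φ (Matrix.fromBlocks 0 0 0 N) := by
    calc (1 - coreProj A) * A
        = (1 - φ (Matrix.fromBlocks 1 0 0 0)) * φ (Matrix.fromBlocks T S 0 N) :=
          congrArg₂ (fun X Y => (1 - X) * Y) hA.coreProj_eq hA.eq_blockConj
      _ = _ := by
        rw [← map_one φ, ← map_sub, ← map_mul, ← Matrix.fromBlocks_one, sub_mul,
          Matrix.fromBlocks_multiply, Matrix.fromBlocks_multiply, sub_eq_add_neg,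
          Matrix.fromBlocks_neg, Matrix.fromBlocks_add]
        simp
  have h2 : A ^ index A * ((1 - coreProj A) * A) =
      φ (Matrix.fromBlocks 0 (tildeT T S N (index A) * N) 0 0) := by
    rw [h1, hA.pow_index, ← map_mul, Matrix.fromBlocks_multiply]
    simp [φ]
  rw [h2, EmbeddingLike.map_eq_zero_iff, ← Matrix.fromBlocks_zero, Matrix.fromBlocks_inj]
  simp

end CoreEPDecomposition

/-- The range of `N` lies in the null space of `M` if and only if `M * N = 0`. -/
theorem range_le_ker_iff_mul_eq_zero {l m p : Type*} [Fintype m] [Fintype p] [DecidableEq p]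
    (M : Matrix l m ℂ) (N : Matrix m p ℂ) :
    LinearMap.range N.mulVecLin ≤ LinearMap.ker M.mulVecLin ↔ M * N = 0 := by
  rw [LinearMap.range_le_ker_iff, ← Matrix.mulVecLin_mul]
  constructor
  · intro h
    ext i j
    simpa [Matrix.mul_apply, Matrix.mulVec, dotProduct] using
      congrFun (LinearMap.congr_fun h (Pi.single j 1)) i
  · intro h
    rw [h, Matrix.mulVecLin_zero]

end GenInv

theorem theorem4p4 (n t k : ℕ) (ht : t ≤ n) (A : Matrix (Fin n) (Fin n) ℂ)
    (hk : GenInv.index A = k) (hk1 : 1 ≤ k)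
    (U : Matrix (Fin n) (Fin n) ℂ) (T : Matrix (Fin t) (Fin t) ℂ)
    (S : Matrix (Fin t) (Fin (n - t)) ℂ) (N : Matrix (Fin (n - t)) (Fin (n - t)) ℂ)
    (hA : GenInv.IsCoreEPDecomposition A ht U T S N) :
    List.TFAE [
      GenInv.IsWGMatrix A,
      GenInv.dmp A = GenInv.coreEP A,
      GenInv.mpcep A = GenInv.cmp A,
      GenInv.coreEP A * A ^ 2 = GenInv.coreEP A * A ^ 2 * GenInv.coreEP A * A,
      LinearMap.range N.mulVecLin ≤ LinearMap.ker (GenInv.tildeT T S N k).mulVecLin] := by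
  subst hk
  rw [GenInv.isWGMatrix_iff, GenInv.mpcep_eq_cmp_iff, GenInv.dmp_eq_coreEP_iff,
    GenInv.coreEP_mul_sq_eq_iff, GenInv.coreProj_mul_sq_eq_iff, hA.pow_mul_eq_zero_iff,
    GenInv.range_le_ker_iff_mul_eq_zero]
  -- All five entries are now the same equation.
  simp
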